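/- Let $K$ be a field of characteristic different from $2$ and let $X$ be a connected partially ordered set (any two elements $x,y$ are joined by a finite sequence $x=x_0,x_1,\dots,x_n=y$ in $X$ with $x_i\le x_{i+1}$ or $x_{i+1}\le x_i$ for each $i$). Let $I(X,K)$ be the $K$-space of functions $f:X\times X\to K$ with $f(x,y)=0$ whenever $x\nleq y$. Let $FI(X,K)$ be the finitary incidence algebra of $X$ over $K$, i.e. the $K$-algebra of all $f\in I(X,K)$ such that for all $x\le y$ there are only finitely many subintervals $[u,v]\subseteq[x,y]$ with $u<v$ and $f(u,v)\ne 0$, with product $(fg)(x,y)=\sum_{x\le z\le y}f(x,z)g(z,y)$. For $x\in X$ let $e_x\in FI(X,K)$ be the element with value $1$ at $(x,x)$ and $0$ elsewhere. An automorphism of a $K$-algebra is inner if it has the form $a\mapsto uau^{-1}$ for some invertible $u$. Suppose that every multiplicative automorphism of $FI(X,K)$ is inner; that is, for every $\sigma\in I(X,K)$ with $\sigma(x,y)\neq 0$ for all $x\le y$ and $\sigma(x,y)\sigma(y,z)=\sigma(x,z)$ whenever $x\le y\le z$, the automorphism $M_\sigma$ of $FI(X,K)$ given by $M_\sigma(f)(x,y)=\sigma(x,y)f(x,y)$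 is inner. An involution on a $K$-algebra $A$ is an additive (not necessarily $K$-linear) map $\rho:A\to A$ with $\rho(ab)=\rho(b)\rho(a)$ and $\rho(\rho(a))=a$ for all $a,b\in A$; it is of the second kind if it is not the identity on the centre of $A$. An involution on $X$ is a map $\lambda:X\to X$ with $\lambda(\lambda(x))=x$ and $x\le y\Leftrightarrow\lambda(y)\le\lambda(x)$ for all $x,y\in X$. Let $\ast:K\to K$, $a\mapsto a^\ast$, be an involution of the second kind on $K$, and let $\lambda$ be an involution on $X$ such that $\lambda(x)\ne x$ for all $x\in X$. Let $\rho_\lambda^\ast$ be the involution on $FI(X,K)$ given by $\rho_\lambda^\ast(f)(x,y)=[f(\lambda(y),\lambda(x))]^\ast$. Let $\rho$ be any involution on $FI(X,K)$ that induces $\lambda$ on $X$ (for every $x\in X$, $\rho(e_x)=u\,e_{\lambda(x)}u^{-1}$ for some invertible $u\in FI(X,K)$, which may depend on $x$) and $\ast$ on $K$ ($\rho(k\cdot 1)=k^\ast\cdot 1$ for all $k\in K$). Then $\rho$ is equivalent to $\rho_\lambda^\ast$ via an inner automorphism: there is an inner automorphism $\Phi$ of $FI(X,K)$ such that $\Phi\circ\rho=\rho_\lambda^\ast\circ\Phi$.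 -/

import Mathlib

noncomputable section

/-! ### Posets -/

/-- A poset is connected if any two of its elements are joined by a finite zigzag
`x = x₀, x₁, …, xₙ = y` with `xᵢ ≤ xᵢ₊₁` or `xᵢ₊₁ ≤ xᵢ` for every `i`. -/
def PosetConnected (X : Type*) [PartialOrder X] : Prop :=
  ∀ x y : X, Relation.ReflTransGen (fun a b : X => a ≤ b ∨ b ≤ a) x y

/-- An involution on a poset: an order-reversing self-inverse map. -/
structure IsPosetInvolution {X : Type*} [PartialOrder X] (lam : X → X) : Prop where
  apply_apply : ∀ x, lam (lam x) = x
  le_iff : ∀ x y, x ≤ y ↔ lam y ≤ lam x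

/-! ### Involutions and inner automorphisms of rings and algebras -/

/-- An involution on a ring: an additive, multiplication-reversing, self-inverse map
(linearity over a base field is not required). -/
structure IsInvolution {A : Type*} [Ring A] (ρ : A → A) : Prop where
  map_add : ∀ a b, ρ (a + b) = ρ a + ρ b
  map_mul : ∀ a b, ρ (a * b) = ρ b * ρ a
  apply_apply : ∀ a, ρ (ρ a) = a

/-- An involution of the second kind: an involution that is not the identity on the centre. -/
def IsInvolutionOfSecondKind {A : Type*} [Ring A] (ρ : A → A) : Prop :=
  IsInvolution ρ ∧ ∃ z ∈ Set.center A, ρ z ≠ z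

/-- An algebra automorphism is inner if it is `a ↦ u a u⁻¹` for some invertible `u`. -/
def IsInnerAut {K A : Type*} [Field K] [Ring A] [Algebra K A] (Φ : A ≃ₐ[K] A) : Prop :=
  ∃ u : Aˣ, ∀ a : A, Φ a = u * a * (u⁻¹ : Aˣ)

/-- Two involutions on a `K`-algebra are equivalent via an inner automorphism `Φ` if
`Φ ∘ ρ₁ = ρ₂ ∘ Φ`. -/
def EquivalentViaInner (K : Type*) {A : Type*} [Field K] [Ring A] [Algebra K A]
    (ρ₁ ρ₂ : A → A) : Prop :=
  ∃ Φ : A ≃ₐ[K] A, IsInnerAut Φ ∧ ⇑Φ ∘ ρ₁ = ρ₂ ∘ ⇑Φ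

/-! ### The finitary incidence algebra

`IncidenceAlgebra K X` is, for an arbitrary poset `X`, the `K`-space `I(X, K)` of functions
`f : X → X → K` with `f x y = 0` unless `x ≤ y`. -/

section

variable (X K : Type*) [PartialOrder X] [Field K]

/-- The pairs `u < v` with `[u, v] ⊆ [x, y]` and `f u v ≠ 0`. -/
def IncidenceAlgebra.nonzeroIn {X K : Type*} [PartialOrder X] [Field K]
    (f : IncidenceAlgebra K X) (x y : X) : Set (X × X) :=
  {p | x ≤ p.1 ∧ p.1 < p.2 ∧ p.2 ≤ y ∧ f p.1 p.2 ≠ 0}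

/-- The subspace of `I(X, K)` of those `f` such that each interval `[x, y]` contains only finitely
many subintervals `[u, v]` with `u ≠ v` and `f u v ≠ 0`. -/
def finitarySubmodule : Submodule K (IncidenceAlgebra K X) where
  carrier := {f | ∀ x y : X, x ≤ y → (f.nonzeroIn x y).Finite}
  add_mem' := by
    intro f g hf hg x y hxy
    refine ((hf x y hxy).union (hg x y hxy)).subset ?_
    rintro ⟨u, v⟩ ⟨h1, h2, h3, h4⟩
    by_cases h : f u v = 0
    · refine Or.inr ⟨h1, h2, h3, fun h' => h4 ?_⟩
      change f u v + g u v = 0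
      simp only at h'
      rw [h, h', add_zero]
    · exact Or.inl ⟨h1, h2, h3, h⟩
  zero_mem' := by
    intro x y _
    refine Set.finite_empty.subset ?_
    rintro p ⟨_, _, _, h4⟩
    exact h4 rfl
  smul_mem' := by
    intro c f hf x y hxy
    refine (hf x y hxy).subset ?_
    rintro ⟨u, v⟩ ⟨h1, h2, h3, h4⟩
    refine ⟨h1, h2, h3, fun h' => h4 ?_⟩
    change c * f u v = 0
    simp only at h'
    rw [h', mul_zero]

/-- The finitary incidence algebra of `X` over `K`. -/
abbrev FI : Type _ := ↥(finitarySubmodule X K)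

end

namespace FI

variable {X K : Type*} [PartialOrder X] [Field K]

theorem ext' {f g : FI X K} (h : ∀ x y, x ≤ y → f.1 x y = g.1 x y) : f = g :=
  Subtype.ext (IncidenceAlgebra.ext h)

/-- For `x ≤ y`, a finite subset of `[x, y]` containing `x`, `y` and the endpoints of all
non-trivial subintervals of `[x, y]` on which one of `f`, `g`, `h` does not vanish. -/
theorem exists_finset (f g h : FI X K) {x y : X} (hxy : x ≤ y) :
    ∃ S : Finset X, x ∈ S ∧ y ∈ S ∧ (↑S ⊆ Set.Icc x y) ∧
      ∀ u v, x ≤ u → u < v → v ≤ y → (f.1 u v ≠ 0 ∨ g.1 u v ≠ 0 ∨ h.1 u v ≠ 0) →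
        u ∈ S ∧ v ∈ S := by
  classical
  have hF := ((f.2 x y hxy).union ((g.2 x y hxy).union (h.2 x y hxy)))
  refine ⟨{x, y} ∪ (hF.toFinset.image Prod.fst ∪ hF.toFinset.image Prod.snd), by simp, by simp,
    ?_, ?_⟩
  · intro z hz
    simp only [Finset.coe_union, Finset.coe_insert, Finset.coe_singleton, Finset.coe_image,
      Set.Finite.coe_toFinset, Set.mem_union, Set.mem_insert_iff, Set.mem_singleton_iff,
      Set.mem_image] at hz
    rcases hz with (rfl | rfl) | ⟨p, hp, rfl⟩ | ⟨p, hp, rfl⟩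
    · exact ⟨le_rfl, hxy⟩
    · exact ⟨hxy, le_rfl⟩
    · rcases hp with hp | hp | hp <;> exact ⟨hp.1, hp.2.1.le.trans hp.2.2.1⟩
    · rcases hp with hp | hp | hp <;> exact ⟨hp.1.trans hp.2.1.le, hp.2.2.1⟩
  · intro u v h1 h2 h3 h4
    have hm : (u, v) ∈ hF.toFinset := by
      rw [Set.Finite.mem_toFinset]
      rcases h4 with h4 | h4 | h4
      · exact Or.inl ⟨h1, h2, h3, h4⟩
      · exact Or.inr (Or.inl ⟨h1, h2, h3, h4⟩)
      · exact Or.inr (Or.inr ⟨h1, h2, h3, h4⟩)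
    exact ⟨Finset.mem_union_right _ (Finset.mem_union_left _ (Finset.mem_image_of_mem _ hm)),
      Finset.mem_union_right _ (Finset.mem_union_right _ (Finset.mem_image_of_mem _ hm))⟩

/-- The convolution `(f g)(x, y) = ∑_{x ≤ z ≤ y} f(x, z) g(z, y)`; for finitary `f` and `g` the
sum has only finitely many nonzero terms. -/
def conv (f g : FI X K) (x y : X) : K := ∑ᶠ z ∈ Set.Icc x y, f.1 x z * g.1 z y

theorem conv_eq_sum (f g : FI X K) (x y : X) (S : Finset X) (hS : ↑S ⊆ Set.Icc x y)
    (h : ∀ z, x ≤ z → z ≤ y → f.1 x z ≠ 0 → g.1 z y ≠ 0 → z ∈ S) :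
    conv f g x y = ∑ z ∈ S, f.1 x z * g.1 z y := by
  refine finsum_mem_eq_sum_of_subset _ ?_ hS
  rintro z ⟨hz, hne⟩
  exact h z hz.1 hz.2 (left_ne_zero_of_mul hne) (right_ne_zero_of_mul hne)

theorem exists_of_conv_ne_zero {f g : FI X K} {x y : X} (h : conv f g x y ≠ 0) :
    ∃ z, x ≤ z ∧ z ≤ y ∧ f.1 x z ≠ 0 ∧ g.1 z y ≠ 0 := by
  obtain ⟨z, hz, hne⟩ := exists_ne_zero_of_finsum_mem_ne_zero h
  exact ⟨z, hz.1, hz.2, left_ne_zero_of_mul hne, right_ne_zero_of_mul hne⟩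

theorem conv_eq_zero (f g : FI X K) {x y : X} (h : ¬ x ≤ y) : conv f g x y = 0 := by
  by_contra hne
  obtain ⟨z, h1, h2, _⟩ := exists_of_conv_ne_zero hne
  exact h (h1.trans h2)

instance : Mul (FI X K) where
  mul f g := ⟨⟨conv f g, fun _ _ h => conv_eq_zero f g h⟩, by
    intro x y hxy
    obtain ⟨S, -, -, -, hS⟩ := exists_finset f g g hxy
    refine (S ×ˢ S).finite_toSet.subset ?_
    rintro ⟨u, v⟩ ⟨h1, h2, h3, h4⟩
    obtain ⟨z, hz1, hz2, hz3, hz4⟩ := exists_of_conv_ne_zero h4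
    simp only at h1 h2 h3 hz1 hz2 hz3 hz4
    simp only [Finset.coe_product, Set.mem_prod, Finset.mem_coe]
    rcases hz1.eq_or_lt with rfl | hlt1
    · exact hS _ _ h1 h2 h3 (Or.inr (Or.inl hz4))
    · rcases hz2.eq_or_lt with rfl | hlt2
      · exact hS _ _ h1 h2 h3 (Or.inl hz3)
      · exact ⟨(hS _ _ h1 hlt1 (hz2.trans h3) (Or.inl hz3)).1,
          (hS _ _ (h1.trans hz1) hlt2 h3 (Or.inr (Or.inl hz4))).2⟩⟩

theorem mul_apply (f g : FI X K) (x y : X) :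
    (f * g).1 x y = ∑ᶠ z ∈ Set.Icc x y, f.1 x z * g.1 z y := rfl

theorem mul_apply_eq_sum (f g : FI X K) (x y : X) (S : Finset X) (hS : ↑S ⊆ Set.Icc x y)
    (h : ∀ z, x ≤ z → z ≤ y → f.1 x z ≠ 0 → g.1 z y ≠ 0 → z ∈ S) :
    (f * g).1 x y = ∑ z ∈ S, f.1 x z * g.1 z y := conv_eq_sum f g x y S hS h

theorem add_apply (f g : FI X K) (x y : X) : (f + g).1 x y = f.1 x y + g.1 x y := rfl

theorem smul_apply (c : K) (f : FI X K) (x y : X) : (c • f).1 x y = c * f.1 x y := rfl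

open Classical in
/-- For `Y ⊆ X`, the element with value `1` at the pairs `(x, x)`, `x ∈ Y`, and `0` elsewhere. -/
def eSet (Y : Set X) : FI X K :=
  ⟨⟨fun u v => if u = v ∧ u ∈ Y then 1 else 0, fun _ _ h => if_neg fun h' => h h'.1.le⟩, by
    intro x y _
    refine Set.finite_empty.subset ?_
    rintro p ⟨_, h2, _, h4⟩
    exact h4 (if_neg fun h' => h2.ne h'.1)⟩

/-- The idempotent `e_x`, with value `1` at `(x, x)` and `0` elsewhere. -/
def e (x : X) : FI X K := eSet {x}

/-- The unity `δ`, with value `1` on the diagonal and `0` elsewhere. -/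
instance : One (FI X K) := ⟨eSet Set.univ⟩

theorem one_apply_self (x : X) : (1 : FI X K).1 x x = 1 := if_pos ⟨rfl, trivial⟩

theorem one_apply_ne {x y : X} (h : x ≠ y) : (1 : FI X K).1 x y = 0 := if_neg fun h' => h h'.1

protected theorem mul_assoc (f g h : FI X K) : f * g * h = f * (g * h) := by
  classical
  apply ext'
  intro x y hxy
  obtain ⟨S, hx, hy, hI, hS⟩ := exists_finset f g h hxy
  have key1 : ∀ z ∈ S, (f * g).1 x z = ∑ w ∈ S, f.1 x w * g.1 w z := by
    intro z hz
    rw [mul_apply_eq_sum f g x z (S.filter (· ≤ z))]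
    · refine Finset.sum_subset (Finset.filter_subset _ _) ?_
      intro w hw hw'
      have : ¬ w ≤ z := fun hle => hw' (Finset.mem_filter.2 ⟨hw, hle⟩)
      rw [IncidenceAlgebra.apply_eq_zero_of_not_le this, mul_zero]
    · intro w hw
      have hw := Finset.mem_filter.1 hw
      exact ⟨(hI hw.1).1, hw.2⟩
    · intro w h1 h2 h3 _
      refine Finset.mem_filter.2 ⟨?_, h2⟩
      rcases h1.eq_or_lt with rfl | hlt
      · exact hx
      · exact (hS _ _ le_rfl hlt (h2.trans (hI hz).2) (Or.inl h3)).2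
  have key2 : ∀ w ∈ S, (g * h).1 w y = ∑ z ∈ S, g.1 w z * h.1 z y := by
    intro w hw
    rw [mul_apply_eq_sum g h w y (S.filter (w ≤ ·))]
    · refine Finset.sum_subset (Finset.filter_subset _ _) ?_
      intro z hz hz'
      have : ¬ w ≤ z := fun hle => hz' (Finset.mem_filter.2 ⟨hz, hle⟩)
      rw [IncidenceAlgebra.apply_eq_zero_of_not_le this, zero_mul]
    · intro z hz
      have hz := Finset.mem_filter.1 hz
      exact ⟨hz.2, (hI hz.1).2⟩
    · intro z h1 h2 _ h4
      refine Finset.mem_filter.2 ⟨?_, h1⟩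
      rcases h2.eq_or_lt with rfl | hlt
      · exact hy
      · exact (hS _ _ ((hI hw).1.trans h1) hlt le_rfl (Or.inr (Or.inr h4))).1
  rw [mul_apply_eq_sum (f * g) h x y S hI, mul_apply_eq_sum f (g * h) x y S hI]
  · rw [Finset.sum_congr rfl fun z hz => by rw [key1 z hz, Finset.sum_mul],
      Finset.sum_comm]
    refine Finset.sum_congr rfl fun w hw => ?_
    rw [key2 w hw, Finset.mul_sum]
    exact Finset.sum_congr rfl fun z _ => mul_assoc _ _ _
  · intro z h1 h2 h3 _
    rcases h1.eq_or_lt with rfl | hlt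
    · exact hx
    · exact (hS _ _ le_rfl hlt h2 (Or.inl h3)).2
  · intro z h1 h2 _ h4
    rcases h2.eq_or_lt with rfl | hlt
    · exact hy
    · exact (hS _ _ h1 hlt le_rfl (Or.inr (Or.inr h4))).1

protected theorem one_mul (f : FI X K) : 1 * f = f := by
  apply ext'
  intro x y hxy
  rw [mul_apply_eq_sum 1 f x y {x} (by simpa using hxy), Finset.sum_singleton, one_apply_self,
    one_mul]
  intro z _ _ h3 _
  by_contra hne
  exact h3 (one_apply_ne fun h => hne (Finset.mem_singleton.2 h.symm))

protected theorem mul_one (f : FI X K) : f * 1 = f := by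
  apply ext'
  intro x y hxy
  rw [mul_apply_eq_sum f 1 x y {y} (by simpa using hxy), Finset.sum_singleton, one_apply_self,
    mul_one]
  intro z _ _ _ h4
  by_contra hne
  exact h4 (one_apply_ne fun h => hne (Finset.mem_singleton.2 h))

theorem exists_sums (f g h : FI X K) {x y : X} (hxy : x ≤ y) :
    ∃ S : Finset X,
      (∀ a b : FI X K, (a = f ∨ a = g ∨ a = h ∨ b = f ∨ b = g ∨ b = h) →
        (a * b).1 x y = ∑ z ∈ S, a.1 x z * b.1 z y) := by
  obtain ⟨S, hx, hy, hI, hS⟩ := exists_finset f g h hxy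
  refine ⟨S, fun a b hab => mul_apply_eq_sum a b x y S hI fun z h1 h2 h3 h4 => ?_⟩
  rcases h1.eq_or_lt with rfl | hlt1
  · exact hx
  rcases h2.eq_or_lt with rfl | hlt2
  · exact hy
  rcases hab with rfl | rfl | rfl | rfl | rfl | rfl
  · exact (hS _ _ le_rfl hlt1 h2 (Or.inl h3)).2
  · exact (hS _ _ le_rfl hlt1 h2 (Or.inr (Or.inl h3))).2
  · exact (hS _ _ le_rfl hlt1 h2 (Or.inr (Or.inr h3))).2
  · exact (hS _ _ h1 hlt2 le_rfl (Or.inl h4)).1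
  · exact (hS _ _ h1 hlt2 le_rfl (Or.inr (Or.inl h4))).1
  · exact (hS _ _ h1 hlt2 le_rfl (Or.inr (Or.inr h4))).1

protected theorem mul_add (f g h : FI X K) : f * (g + h) = f * g + f * h := by
  apply ext'
  intro x y hxy
  obtain ⟨S, hS⟩ := exists_sums f g h hxy
  rw [add_apply, hS f (g + h) (by simp), hS f g (by simp), hS f h (by simp),
    ← Finset.sum_add_distrib]
  exact Finset.sum_congr rfl fun z _ => by rw [add_apply, mul_add]

protected theorem add_mul (f g h : FI X K) : (f + g) * h = f * h + g * h := by
  apply ext'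
  intro x y hxy
  obtain ⟨S, hS⟩ := exists_sums f g h hxy
  rw [add_apply, hS (f + g) h (by simp), hS f h (by simp), hS g h (by simp),
    ← Finset.sum_add_distrib]
  exact Finset.sum_congr rfl fun z _ => by rw [add_apply, add_mul]

protected theorem smul_mul (c : K) (f g : FI X K) : c • f * g = c • (f * g) := by
  apply ext'
  intro x y hxy
  obtain ⟨S, hS⟩ := exists_sums f g g hxy
  rw [smul_apply, hS (c • f) g (by simp), hS f g (by simp), Finset.mul_sum]
  exact Finset.sum_congr rfl fun z _ => by rw [smul_apply, mul_assoc]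

protected theorem mul_smul (c : K) (f g : FI X K) : f * c • g = c • (f * g) := by
  apply ext'
  intro x y hxy
  obtain ⟨S, hS⟩ := exists_sums f g g hxy
  rw [smul_apply, hS f (c • g) (by simp), hS f g (by simp), Finset.mul_sum]
  exact Finset.sum_congr rfl fun z _ => by rw [smul_apply, mul_left_comm]

instance : Ring (FI X K) where
  __ := (inferInstance : AddCommGroup (FI X K))
  mul := (· * ·)
  one := 1
  mul_assoc := FI.mul_assoc
  one_mul := FI.one_mul
  mul_one := FI.mul_one
  left_distrib := FI.mul_add
  right_distrib := FI.add_mul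
  zero_mul f := by simpa using FI.smul_mul (0 : K) 0 f
  mul_zero f := by simpa using FI.mul_smul (0 : K) f 0

/-- `FI X K` is a `K`-algebra, with its scalar multiplication as a subspace of `I(X, K)`; in
particular `algebraMap K (FI X K) k = k • 1`. -/
instance : Algebra K (FI X K) := Algebra.ofModule FI.smul_mul FI.mul_smul

/-! ### Multiplicative automorphisms -/

/-- `σ ∈ I(X, K)` is multiplicative if `σ(x, y) ≠ 0` for `x ≤ y` and
`σ(x, y) σ(y, z) = σ(x, z)` for `x ≤ y ≤ z`. -/
structure IsMultiplicative (σ : IncidenceAlgebra K X) : Prop where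
  ne_zero : ∀ x y, x ≤ y → σ x y ≠ 0
  mul_eq : ∀ x y z, x ≤ y → y ≤ z → σ x y * σ y z = σ x z

/-- The entrywise product `(x, y) ↦ σ(x, y) f(x, y)`. -/
def hadamard (σ : X → X → K) (f : FI X K) : FI X K :=
  ⟨⟨fun x y => σ x y * f.1 x y, fun _ _ h => by
      rw [IncidenceAlgebra.apply_eq_zero_of_not_le h, mul_zero]⟩, by
    intro x y hxy
    refine (f.2 x y hxy).subset ?_
    rintro p ⟨h1, h2, h3, h4⟩
    exact ⟨h1, h2, h3, right_ne_zero_of_mul h4⟩⟩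

theorem hadamard_apply (σ : X → X → K) (f : FI X K) (x y : X) :
    (hadamard σ f).1 x y = σ x y * f.1 x y := rfl

theorem hadamard_mul {σ : IncidenceAlgebra K X} (hσ : IsMultiplicative σ) (f g : FI X K) :
    hadamard σ (f * g) = hadamard σ f * hadamard σ g := by
  apply ext'
  intro x y hxy
  obtain ⟨T, hT⟩ := exists_sums f g (hadamard σ f) hxy
  rw [hadamard_apply, hT f g (by simp), hT (hadamard σ f) _ (by simp), Finset.mul_sum]
  refine Finset.sum_congr rfl fun z _ => ?_
  rw [hadamard_apply, hadamard_apply]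
  by_cases h1 : x ≤ z
  · by_cases h2 : z ≤ y
    · rw [← hσ.mul_eq x z y h1 h2]; ring
    · rw [IncidenceAlgebra.apply_eq_zero_of_not_le h2 g.1]; ring
  · rw [IncidenceAlgebra.apply_eq_zero_of_not_le h1 f.1]; ring

/-- The multiplicative automorphism `M_σ` of `FI X K`, `M_σ(f)(x, y) = σ(x, y) f(x, y)`. -/
def multAut (σ : IncidenceAlgebra K X) (hσ : IsMultiplicative σ) : FI X K ≃ₐ[K] FI X K :=
  AlgEquiv.ofLinearEquiv
    { toFun := hadamard σ
      invFun := hadamard fun x y => (σ x y)⁻¹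
      map_add' := fun f g => ext' fun x y _ => by
        simp only [hadamard_apply, add_apply, mul_add]
      map_smul' := fun c f => ext' fun x y _ => by
        simp only [hadamard_apply, smul_apply, RingHom.id_apply, mul_left_comm]
      left_inv := fun f => ext' fun x y hxy => by
        simp only [hadamard_apply, inv_mul_cancel_left₀ (hσ.ne_zero x y hxy)]
      right_inv := fun f => ext' fun x y hxy => by
        simp only [hadamard_apply, mul_inv_cancel_left₀ (hσ.ne_zero x y hxy)] }
    (ext' fun x y _ => by
      change σ x y * (1 : FI X K).1 x y = (1 : FI X K).1 x y
      by_cases h : x = y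
      · subst h
        have h1 := hσ.mul_eq x x x le_rfl le_rfl
        rw [one_apply_self, mul_one]
        exact mul_left_cancel₀ (hσ.ne_zero x x le_rfl) (by rw [h1, mul_one])
      · rw [one_apply_ne h, mul_zero])
    (hadamard_mul hσ)

theorem multAut_apply (σ : IncidenceAlgebra K X) (hσ : IsMultiplicative σ) (f : FI X K) (x y : X) :
    (multAut σ hσ f).1 x y = σ x y * f.1 x y := rfl

/-! ### Involutions of the finitary incidence algebra -/

/-- The map `ρ_λ^*`, `ρ_λ^*(f)(x, y) = (f(λ(y), λ(x)))^*`. -/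
def rho {lam : X → X} (hlam : IsPosetInvolution lam) {star : K → K} (hstar : IsInvolution star)
    (f : FI X K) : FI X K :=
  have h0 : star 0 = 0 := by simpa using hstar.map_add 0 0
  ⟨⟨fun x y => star (f.1 (lam y) (lam x)), fun x y h => by
      rw [IncidenceAlgebra.apply_eq_zero_of_not_le (mt (hlam.le_iff x y).2 h), h0]⟩, by
    intro x y hxy
    refine ((f.2 _ _ ((hlam.le_iff x y).1 hxy)).image
      (fun p : X × X => (lam p.2, lam p.1))).subset ?_
    rintro ⟨u, v⟩ ⟨h1, h2, h3, h4⟩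
    refine ⟨(lam v, lam u), ⟨(hlam.le_iff _ _).1 h3, ?_, (hlam.le_iff _ _).1 h1, fun h => ?_⟩, ?_⟩
    · refine lt_of_le_of_ne ((hlam.le_iff _ _).1 h2.le) fun h => h2.ne ?_
      have h' := congrArg lam h
      simp only [hlam.apply_apply] at h'
      exact h'.symm
    · refine h4 ?_
      change star (f.1 (lam v) (lam u)) = 0
      rw [h, h0]
    · simp only [hlam.apply_apply]⟩

theorem rho_apply {lam : X → X} (hlam : IsPosetInvolution lam) {star : K → K}
    (hstar : IsInvolution star) (f : FI X K) (x y : X) :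
    (rho hlam hstar f).1 x y = star (f.1 (lam y) (lam x)) := rfl

/-- `ρ` induces the map `λ` on `X`: each `ρ(e_x)` is conjugate to `e_{λ(x)}`. -/
def InducesOnPoset (ρ : FI X K → FI X K) (lam : X → X) : Prop :=
  ∀ x : X, ∃ u : (FI X K)ˣ, ρ (e x) = ↑u * (e (lam x) : FI X K) * ↑u⁻¹

/-- `ρ` induces the map `*` on `K`: it restricts to `*` on the scalars `K ⊆ FI X K`. -/
def InducesOnField (ρ : FI X K → FI X K) (star : K → K) : Prop :=
  ∀ k : K, ρ (algebraMap K (FI X K) k) = algebraMap K (FI X K) (star k)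

end FI

end

/-! Write `r` for `rho hlam hstar`. The plan is to show that `ρ` is `r` followed by conjugation by a
unit `v`, and that `v` can be written as `h * r h`; conjugation by `h⁻¹` then carries `ρ` to `r`.

For the first part, `φ = r ∘ ρ` is a `K`-linear automorphism, and `φ (e x)` has entry `1` at `(x,
x)`. Taking column `y` from `φ (e y)` for every `y` gives a matrix `W` with `φ (e x) * W = W * e x`.
The delicate point is that `W` is finitary (`finite_setOf_map_e_apply_ne_zero`). After conjugation
by `W` the automorphism fixes every `e x`, so it is multiplicative, hence inner by hypothesis.

For the second part, `ρ ∘ ρ = id` makes `v * (r v)⁻¹` central, so by connectedness it is a scalar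
`k`, with `k * star k = 1`. Hilbert 90 for `star` rescales `v` so that `r v = v`. As `lam` has no
fixed points, some lower set `D` is exchanged with its complement. Every matrix is block triangular
with respect to `D`, and `r` interchanges the two diagonal blocks, so a symmetric `v` factors
explicitly as `h * r h`, the off-diagonal block being shared in two halves (`exists_eq_mul_map`). -/

/-! ### Two consequences of Zorn's lemma -/

/-- An infinite set on which `g` has no fixed points has an infinite subset disjoint from its
image under `g`. -/
theorem Set.Infinite.exists_infinite_subset_forall_notMem {α : Type*} {V : Set α}
    (hV : V.Infinite) (g : α → α) (hg : ∀ v ∈ V, g v ≠ v) :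
    ∃ A ⊆ V, A.Infinite ∧ ∀ a ∈ A, g a ∉ A := by
  by_cases hfib : ∃ b, (V ∩ g ⁻¹' {b}).Infinite
  · obtain ⟨b, hb⟩ := hfib
    -- An infinite fibre over `b` works: if it contained `b`, then `b` would be a fixed point in
    -- `V`.
    refine ⟨_, Set.inter_subset_left, hb, ?_⟩
    rintro a ⟨ha, hab⟩ ⟨hga, hgb⟩
    rw [Set.mem_preimage, Set.mem_singleton_iff] at hab hgb
    rw [hab] at hgb hga
    exact hg b hga hgb
  · simp only [not_exists, Set.not_infinite] at hfib
    obtain ⟨A, hA⟩ := zorn_subset {A : Set α | A ⊆ V ∧ ∀ a ∈ A, g a ∉ A} (by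
      intro C hC hchain
      refine ⟨⋃₀ C, ⟨Set.sUnion_subset fun A hA => (hC hA).1, ?_⟩,
        fun A hA => Set.subset_sUnion_of_mem hA⟩
      rintro a ⟨A, hA, haA⟩ ⟨B, hB, hgB⟩
      rcases hchain.total hA hB with h | h
      · exact (hC hB).2 a (h haA) hgB
      · exact (hC hA).2 a haA (h hgB))
    refine ⟨A, hA.prop.1, fun hfin => hV ?_, hA.prop.2⟩
    -- With finite fibres, a finite maximal `A` would give a finite set `A ∪ g '' A ∪ (V ∩ g ⁻¹'
    -- A)`. It exhausts `V`, since any other `v` could be added to `A`.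
    refine ((hfin.union (hfin.image g)).union (hfin.biUnion fun b _ => hfib b)).subset ?_
    intro v hv
    by_contra hcon
    simp only [Set.mem_union, Set.mem_image, Set.mem_iUnion, not_or, not_exists, not_and,
      Set.mem_inter_iff, Set.mem_preimage, Set.mem_singleton_iff, exists_prop] at hcon
    obtain ⟨⟨h1, h2⟩, h3⟩ := hcon
    refine h1 (hA.le_of_ge (y := insert v A) ⟨Set.insert_subset hv hA.prop.1, ?_⟩
      (Set.subset_insert _ _) (Set.mem_insert _ _))
    rintro a (rfl | ha) (h | h)
    · exact hg _ hv h
    · exact h3 _ h hv rfl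
    · exact h2 a ha h
    · exact hA.prop.2 a ha h

/-- A fixed-point-free involution of a poset exchanges some lower set and its complement. -/
theorem IsPosetInvolution.exists_isLowerSet {X : Type*} [PartialOrder X] {lam : X → X}
    (hlam : IsPosetInvolution lam) (hfix : ∀ x, lam x ≠ x) :
    ∃ D : Set X, IsLowerSet D ∧ ∀ x, lam x ∈ D ↔ x ∉ D := by
  obtain ⟨D, hD⟩ := zorn_subset {D : Set X | IsLowerSet D ∧ ∀ x ∈ D, lam x ∉ D} (by
    intro C hC hchain
    refine ⟨⋃₀ C, ⟨isLowerSet_sUnion fun A hA => (hC hA).1, ?_⟩,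
      fun A hA => Set.subset_sUnion_of_mem hA⟩
    rintro a ⟨A, hA, haA⟩ ⟨B, hB, hgB⟩
    rcases hchain.total hA hB with h | h
    · exact (hC hB).2 a (h haA) hgB
    · exact (hC hA).2 a haA (h hgB))
  obtain ⟨hlow, hdisj⟩ := hD.prop
  -- Under these conditions `D ∪ Set.Iic x` is still disjoint from its image, so maximality absorbs
  -- `x`.
  have key : ∀ x, lam x ∉ D → ¬ lam x ≤ x → x ∈ D := by
    intro x hx hle
    refine hD.le_of_ge (y := D ∪ Set.Iic x) ⟨hlow.union (isLowerSet_Iic x), ?_⟩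
      Set.subset_union_left (Or.inr le_rfl)
    rintro z (hz | hz) (h | h)
    · exact hdisj z hz h
    · exact hx (hlow (by simpa [hlam.apply_apply] using (hlam.le_iff _ _).1 h) hz)
    · exact hx (hlow ((hlam.le_iff _ _).1 hz) h)
    · exact hle (((hlam.le_iff _ _).1 hz).trans h)
  refine ⟨D, hlow, fun x => ⟨fun h hx => hdisj x hx h, fun hx => ?_⟩⟩
  by_contra hx'
  -- If `D` missed both `x` and `lam x`, then `key` would apply to one of them, because distinct
  -- elements cannot satisfy both inequalities.
  by_cases hle : lam x ≤ x
  · refine hx' (key (lam x) (by rwa [hlam.apply_apply]) fun h => ?_)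
    rw [hlam.apply_apply] at h
    exact hfix x (le_antisymm hle h)
  · exact hx (key x hx' hle)

/-! ### Involutions of rings -/

namespace IsInvolution

variable {A : Type*} [Ring A] {r : A → A}

theorem map_one (hr : IsInvolution r) : r 1 = 1 := by
  have h := hr.map_mul (r 1) 1
  rwa [hr.apply_apply, mul_one, hr.apply_apply, eq_comm] at h

theorem map_zero (hr : IsInvolution r) : r 0 = 0 := by simpa using hr.map_add 0 0

theorem map_neg (hr : IsInvolution r) (a : A) : r (-a) = -r a := by
  refine eq_neg_of_add_eq_zero_left ?_
  rw [← hr.map_add, neg_add_cancel, hr.map_zero]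

theorem map_sub (hr : IsInvolution r) (a b : A) : r (a - b) = r a - r b := by
  rw [sub_eq_add_neg, hr.map_add, hr.map_neg, ← sub_eq_add_neg]

/-- An involution maps units to units. -/
def mapUnit (hr : IsInvolution r) (u : Aˣ) : Aˣ where
  val := r u
  inv := r (u⁻¹ : Aˣ)
  val_inv := by rw [← hr.map_mul, Units.inv_mul, hr.map_one]
  inv_val := by rw [← hr.map_mul, Units.mul_inv, hr.map_one]

/-- A symmetric unit `v` that is triangular with respect to an idempotent `e` and its complement
`1 - e = r e` is of the form `h * r h`. -/
theorem exists_eq_mul_map {K : Type*} [Field K] [Algebra K A] (h2 : (2 : K) ≠ 0)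
    (hr : IsInvolution r) (hr2 : ∀ a, r ((2⁻¹ : K) • a) = (2⁻¹ : K) • r a) {e : A}
    (he : e * e = e) (hre : r e = 1 - e) (v : Aˣ) (hv : r v = v)
    (hve : e * (v * e) = v * e) (hwe : e * ((v⁻¹ : Aˣ) * e) = (v⁻¹ : Aˣ) * e) :
    ∃ h : Aˣ, (v : A) = h * r h := by
  have hw : r (v⁻¹ : Aˣ) = (v⁻¹ : Aˣ) := by
    have h := hr.map_mul (v⁻¹ : Aˣ) v
    rw [Units.inv_mul, hr.map_one, hv] at h
    exact left_inv_eq_right_inv (by rw [← hv, ← hr.map_mul, Units.mul_inv, hr.map_one]) v.mul_inv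
  have he' : ∀ a, e * (e * a) = e * a := fun a => by rw [← mul_assoc, he]
  have hve' : ∀ a, e * (v * (e * a)) = v * (e * a) := fun a => by
    rw [← mul_assoc (v : A), ← mul_assoc e, hve]
  have hwe' : ∀ a, e * ((v⁻¹ : Aˣ) * (e * a)) = (v⁻¹ : Aˣ) * (e * a) := fun a => by
    rw [← mul_assoc ((v⁻¹ : Aˣ) : A), ← mul_assoc e, hwe]
  set w : A := ((v⁻¹ : Aˣ) : A) with hwdef
  have hvw : (v : A) * w = 1 := v.mul_inv
  have hwv : w * (v : A) = 1 := v.inv_mul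
  have hvw' : ∀ a, (v : A) * (w * a) = a := fun a => by rw [← mul_assoc, hvw, one_mul]
  have hwv' : ∀ a, w * ((v : A) * a) = a := fun a => by rw [← mul_assoc, hwv, one_mul]
  -- In blocks for `e` and `1 - e`, let `v` have rows `(P, Q)` and `(0, S)`. Then `b` has the single
  -- corner block `½ Q S⁻¹`.
  let b : A := (2⁻¹ : K) • (e - v * (e * w))
  have hb : b = (2⁻¹ : K) • (e - v * (e * w)) := rfl
  have hbe : b * e = 0 := by
    rw [hb]
    simp only [smul_mul_assoc, sub_mul, mul_assoc, he, hwe, hvw', sub_self, smul_zero]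
  have heb : e * b = b := by
    rw [hb]
    simp only [mul_smul_comm, mul_sub, he, hve']
  have hbb : b * b = 0 := by rw [← heb, ← mul_assoc, mul_assoc e, hbe]; simp
  have hbe' : ∀ a, b * (e * a) = 0 := fun a => by rw [← mul_assoc, hbe, zero_mul]
  have hbwe : b * (w * e) = 0 := by rw [← hwe, hbe']
  have hbve : b * (v * e) = 0 := by rw [← hve, hbe']
  have hwb : e * (w * b) = w * b := by rw [← heb, hwe']
  have hbwb : b * (w * b) = 0 := by rw [← hwb, hbe']
  -- Here `h` has rows `(P, ½ Q S⁻¹)` and `(0, 1)`. Symmetry of `v` makes `r h` have rows `(1, ½ P⁻¹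
  -- Q)` and `(0, S)`, and the two halves of `Q` add up in the product.
  refine ⟨⟨v * e + b + (1 - e), w * e - w * (e * b) + (1 - e), ?_, ?_⟩, ?_⟩
  · simp only [add_mul, mul_add, mul_sub, sub_mul, mul_one, one_mul, mul_assoc, he, hwe, hvw',
      hbe, hbwe, heb, hwb, hbwb]
    abel
  · simp only [add_mul, mul_add, mul_sub, sub_mul, mul_one, one_mul, mul_assoc, he, hve,
      hwv', hbe, hbve, hbb, heb, mul_zero]
    abel
  · have hwwe : ∀ a, e * (w * (w * (e * a))) = w * (w * (e * a)) := fun a => by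
      rw [← hwe' a, hwe' (w * (e * a))]
    have hrb : r b = (2⁻¹ : K) • ((1 - e) - w * ((1 - e) * v)) := by
      rw [hb, hr2, hr.map_sub, hr.map_mul, hr.map_mul, hv, hw, hre, mul_assoc]
    change (v : A) = (v * e + b + (1 - e)) * r (v * e + b + (1 - e))
    rw [hr.map_add, hr.map_add, hr.map_sub, hr.map_mul, hr.map_one, hrb, hre, hv, hb]
    simp only [add_mul, mul_add, mul_sub, sub_mul, mul_one, one_mul, mul_assoc, he, he', hwe,
      hwe', hwwe, hvw', hwv, smul_mul_assoc, mul_smul_comm, smul_sub]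
    match_scalars <;> field_simp <;> ring

end IsInvolution

/-- Hilbert's Theorem 90 for a non-trivial involution of a field. -/
theorem IsInvolutionOfSecondKind.exists_mul_eq {K : Type*} [Field K] {star : K → K}
    (hs : IsInvolutionOfSecondKind star) {k : K} (hk : k * star k = 1) :
    ∃ c : K, c ≠ 0 ∧ star c * star k = c := by
  by_cases h : star k = -1
  · obtain ⟨z, -, hz⟩ := hs.2
    refine ⟨z - star z, sub_ne_zero.2 hz.symm, ?_⟩
    rw [hs.1.map_sub, hs.1.apply_apply, h]
    ring
  -- The usual witness `1 + star k` vanishes only in the case treated above, where an element moved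
  -- by `star` is needed.
  · refine ⟨1 + star k, fun h' => h (by linear_combination h'), ?_⟩
    rw [hs.1.map_add, hs.1.map_one, hs.1.apply_apply, add_mul, hk, one_mul, add_comm]

namespace FI

variable {X K : Type*} [PartialOrder X] [Field K]

/-! ### Entries of products -/

theorem sub_apply (f g : FI X K) (x y : X) : (f - g).1 x y = f.1 x y - g.1 x y := rfl

theorem sum_apply {ι : Type*} (s : Finset ι) (f : ι → FI X K) (x y : X) :
    (∑ i ∈ s, f i).1 x y = ∑ i ∈ s, (f i).1 x y := by
  classical
  induction s using Finset.induction_on with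
  | empty => rfl
  | insert i s hi ih => rw [Finset.sum_insert hi, Finset.sum_insert hi, add_apply, ih]

theorem mul_apply_self (f g : FI X K) (x : X) : (f * g).1 x x = f.1 x x * g.1 x x := by
  rw [mul_apply_eq_sum f g x x {x} (by simp), Finset.sum_singleton]
  exact fun z h1 h2 _ _ => Finset.mem_singleton.2 (le_antisymm h2 h1)

theorem mul_apply_congr_right {f g h : FI X K} {x y : X}
    (H : ∀ z, x ≤ z → z ≤ y → g.1 z y = h.1 z y) : (f * g).1 x y = (f * h).1 x y :=
  finsum_mem_congr rfl fun z hz => by rw [H z hz.1 hz.2]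

theorem mul_apply_congr_left {f g h : FI X K} {x y : X}
    (H : ∀ z, x ≤ z → z ≤ y → f.1 x z = g.1 x z) : (f * h).1 x y = (g * h).1 x y :=
  finsum_mem_congr rfl fun z hz => by rw [H z hz.1 hz.2]

theorem exists_of_mul_ne_zero {f g : FI X K} {x y : X} (h : (f * g).1 x y ≠ 0) :
    ∃ z, x ≤ z ∧ z ≤ y ∧ f.1 x z ≠ 0 ∧ g.1 z y ≠ 0 := exists_of_conv_ne_zero h

theorem eSet_apply_self_of_mem {Y : Set X} {x : X} (h : x ∈ Y) :
    (eSet Y : FI X K).1 x x = 1 := if_pos ⟨rfl, h⟩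

theorem eSet_apply_of_ne (Y : Set X) {x y : X} (h : x ≠ y) : (eSet Y : FI X K).1 x y = 0 :=
  if_neg fun h' => h h'.1

theorem eSet_apply_of_notMem {Y : Set X} {x : X} (h : x ∉ Y) (y : X) :
    (eSet Y : FI X K).1 x y = 0 := if_neg fun h' => h h'.2

open Classical in
theorem eSet_mul_apply (Y : Set X) (f : FI X K) (x y : X) :
    (eSet Y * f).1 x y = if x ∈ Y then f.1 x y else 0 := by
  split_ifs with h
  · rw [← one_mul f]
    conv_lhs => rw [one_mul]
    refine mul_apply_congr_left fun z _ _ => ?_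
    by_cases hz : x = z
    · subst hz; rw [eSet_apply_self_of_mem h, one_apply_self]
    · rw [eSet_apply_of_ne _ hz, one_apply_ne hz]
  · by_contra hne
    obtain ⟨z, _, _, hz, _⟩ := exists_of_mul_ne_zero hne
    exact hz (eSet_apply_of_notMem h z)

open Classical in
theorem mul_eSet_apply (Y : Set X) (f : FI X K) (x y : X) :
    (f * eSet Y).1 x y = if y ∈ Y then f.1 x y else 0 := by
  split_ifs with h
  · rw [← mul_one f]
    conv_lhs => rw [mul_one]
    refine mul_apply_congr_right fun z _ _ => ?_
    by_cases hz : z = y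
    · subst hz; rw [eSet_apply_self_of_mem h, one_apply_self]
    · rw [eSet_apply_of_ne _ hz, one_apply_ne hz]
  · by_contra hne
    obtain ⟨z, _, _, _, hz⟩ := exists_of_mul_ne_zero hne
    by_cases hz' : z = y
    · exact hz (eSet_apply_of_notMem (hz' ▸ h) y)
    · exact hz (eSet_apply_of_ne _ hz')

theorem eSet_mul_eSet (Y Z : Set X) : (eSet Y : FI X K) * eSet Z = eSet (Y ∩ Z) := by
  apply ext'
  intro x y _
  rw [eSet_mul_apply]
  by_cases hxy : x = y
  · subst hxy
    by_cases h1 : x ∈ Y <;> by_cases h2 : x ∈ Z <;> simp [eSet, h1, h2]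
  · simp [eSet_apply_of_ne _ hxy]

theorem eSet_empty : (eSet ∅ : FI X K) = 0 :=
  ext' fun _ _ _ => eSet_apply_of_notMem (Set.notMem_empty _) _

theorem e_mul_e_of_ne {x y : X} (h : x ≠ y) : (e x : FI X K) * e y = 0 := by
  rw [e, e, eSet_mul_eSet, Set.singleton_inter_eq_empty.2 (by simpa using h), eSet_empty]

theorem e_mul_e_self (x : X) : (e x : FI X K) * e x = e x := by
  rw [e, eSet_mul_eSet, Set.inter_self]

open Classical in
/-- The matrix unit `e_{xy}`, with value `1` at `(x, y)` and `0` elsewhere, for `x ≤ y`. -/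
noncomputable def single {x y : X} (hxy : x ≤ y) : FI X K :=
  ⟨⟨fun u v => if u = x ∧ v = y then 1 else 0, fun u v h => if_neg fun h' =>
      h (h'.1.trans_le (hxy.trans_eq h'.2.symm))⟩, by
    intro a b _
    refine (Set.finite_singleton (x, y)).subset ?_
    rintro ⟨u, v⟩ ⟨_, _, _, h4⟩
    by_contra hne
    exact h4 (if_neg fun h' => hne (Prod.ext h'.1 h'.2))⟩

theorem single_apply_self {x y : X} (hxy : x ≤ y) : (single hxy : FI X K).1 x y = 1 :=
  if_pos ⟨rfl, rfl⟩

theorem single_apply_of_ne {x y u v : X} (hxy : x ≤ y) (h : ¬ (u = x ∧ v = y)) :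
    (single hxy : FI X K).1 u v = 0 := if_neg h

theorem e_mul_mul_e (f : FI X K) {x y : X} (hxy : x ≤ y) :
    e x * f * e y = f.1 x y • single hxy := by
  apply ext'
  intro u v _
  rw [smul_apply, e, e, mul_eSet_apply, eSet_mul_apply]
  by_cases h : u = x ∧ v = y
  · obtain ⟨rfl, rfl⟩ := h
    simp [single_apply_self]
  · rw [single_apply_of_ne hxy h]
    grind

theorem single_mul_single {x y z : X} (hxy : x ≤ y) (hyz : y ≤ z) :
    (single hxy : FI X K) * single hyz = single (hxy.trans hyz) := by
  apply ext'
  intro u v huv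
  by_cases h : u = x ∧ v = z
  · obtain ⟨rfl, rfl⟩ := h
    rw [mul_apply_eq_sum _ _ u v {y} (by simp [hxy, hyz]), Finset.sum_singleton]
    · simp only [single_apply_self, mul_one]
    · intro t _ _ h3 _
      by_contra hne
      exact h3 (single_apply_of_ne _ fun h' => hne (Finset.mem_singleton.2 h'.2))
  · rw [single_apply_of_ne _ h]
    by_contra hne
    obtain ⟨t, _, _, h3, h4⟩ := exists_of_mul_ne_zero hne
    refine h ⟨?_, ?_⟩
    · by_contra h'; exact h3 (single_apply_of_ne _ fun h'' => h' h''.1)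
    · by_contra h'; exact h4 (single_apply_of_ne _ fun h'' => h' h''.2)

/-! ### The centre -/

/-- Over a connected poset, the centre of the finitary incidence algebra is the base field. -/
theorem exists_eq_algebraMap_of_central (hX : PosetConnected X) {z : FI X K}
    (hz : ∀ a, z * a = a * z) : ∃ k : K, z = algebraMap K (FI X K) k := by
  classical
  rcases isEmpty_or_nonempty X with hE | ⟨⟨x₀⟩⟩
  · exact ⟨0, ext' fun x => hE.elim x⟩
  have hdiag : ∀ x y, x ≤ y → z.1 x x = z.1 y y := by
    intro x y hxy
    have h := congrArg (fun f : FI X K => f.1 x y) (hz (single hxy))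
    rw [mul_apply_eq_sum _ _ x y {x} (by simpa using hxy), Finset.sum_singleton,
      mul_apply_eq_sum _ _ x y {y} (by simpa using hxy), Finset.sum_singleton,
      single_apply_self, mul_one, one_mul] at h
    · exact h
    · intro t _ _ h3 _
      by_contra hne
      exact h3 (single_apply_of_ne _ fun h' => hne (Finset.mem_singleton.2 h'.2))
    · intro t _ _ _ h4
      by_contra hne
      exact h4 (single_apply_of_ne _ fun h' => hne (Finset.mem_singleton.2 h'.1))
  have hconst : ∀ x, z.1 x₀ x₀ = z.1 x x := by
    intro x
    induction hX x₀ x with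
    | refl => rfl
    | tail _ h ih => exact ih.trans (h.elim (hdiag _ _) fun h => (hdiag _ _ h).symm)
  refine ⟨z.1 x₀ x₀, ext' fun x y _ => ?_⟩
  rw [Algebra.algebraMap_eq_smul_one, smul_apply]
  by_cases hxy : x = y
  · subst hxy
    rw [one_apply_self, mul_one, hconst]
  · have h := congrArg (fun f : FI X K => f.1 x y) (hz (e x))
    simp only [e, mul_eSet_apply, eSet_mul_apply, Set.mem_singleton_iff] at h
    rw [if_neg (Ne.symm hxy), if_true] at h
    rw [one_apply_ne hxy, mul_zero, ← h]

/-! ### Invertible elements -/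

/-- If `n` vanishes on the diagonal, the powers of `n` vanish eventually on every interval. -/
theorem exists_pow_apply_eq_zero {n : FI X K} (hn : ∀ x, n.1 x x = 0) {x y : X} (hxy : x ≤ y) :
    ∃ N : ℕ, ∀ k, N ≤ k → ∀ z, x ≤ z → (n ^ k).1 z y = 0 := by
  classical
  obtain ⟨S, hx, hy, hI, hS⟩ := exists_finset n n n hxy
  -- Each factor `n` moves strictly up to another point of `S`, so the number of points of `S` above
  -- `z` bounds the exponent.
  have key : ∀ k z, x ≤ z → (n ^ k).1 z y ≠ 0 → k ≤ (S.filter (z < ·)).card := by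
    intro k
    induction k with
    | zero => intros; exact Nat.zero_le _
    | succ k ih =>
      intro z hz h
      rw [pow_succ'] at h
      obtain ⟨t, h1, h2, h3, h4⟩ := exists_of_mul_ne_zero h
      have hlt : z < t := lt_of_le_of_ne h1 fun h' => h3 (h' ▸ hn z)
      refine Nat.succ_le_of_lt ((ih t (hz.trans h1) h4).trans_lt (Finset.card_lt_card ?_))
      refine Finset.ssubset_iff_subset_ne.2 ⟨fun s hs => ?_, fun heq => ?_⟩
      · rw [Finset.mem_filter] at hs ⊢
        exact ⟨hs.1, hlt.trans hs.2⟩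
      · have : t ∈ S.filter (z < ·) :=
          Finset.mem_filter.2 ⟨(hS z t hz hlt h2 (Or.inl h3)).2, hlt⟩
        rw [← heq, Finset.mem_filter] at this
        exact lt_irrefl _ this.2
  refine ⟨S.card + 1, fun k hk z hz => ?_⟩
  by_contra hne
  have := (key k z hz hne).trans (Finset.card_le_card (Finset.filter_subset _ _))
  omega

/-- If `n` vanishes on the diagonal, the geometric series of `n` converges in the finitary incidence
algebra: on every interval its partial sums are eventually constant. -/
theorem exists_geomSum {n : FI X K} (hn : ∀ x, n.1 x x = 0) :
    ∃ g : FI X K, ∀ x y, x ≤ y → ∃ N₀ : ℕ, ∀ N, N₀ ≤ N → ∀ z, x ≤ z → z ≤ y →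
      g.1 z y = (∑ k ∈ Finset.range N, n ^ k).1 z y := by
  classical
  choose N hN using fun (x y : X) (hxy : x ≤ y) => exists_pow_apply_eq_zero hn hxy
  have hstab : ∀ x y (hxy : x ≤ y) z, x ≤ z → z ≤ y → ∀ M, N x y hxy ≤ M →
      (∑ k ∈ Finset.range M, n ^ k).1 z y
        = (∑ k ∈ Finset.range (N x y hxy), n ^ k).1 z y := by
    intro x y hxy z h1 h2 M hM
    rw [sum_apply, sum_apply]
    refine (Finset.sum_subset (Finset.range_subset_range.2 hM) fun k _ hk => ?_).symm
    exact hN x y hxy k (by simpa using hk) z h1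
  let G : IncidenceAlgebra K X := ⟨fun x y =>
    if hxy : x ≤ y then (∑ k ∈ Finset.range (N x y hxy), n ^ k).1 x y else 0,
    fun x y h => dif_neg h⟩
  have hG : ∀ x y (hxy : x ≤ y),
      G x y = (∑ k ∈ Finset.range (N x y hxy), n ^ k).1 x y := fun x y hxy => dif_pos hxy
  refine ⟨⟨G, ?_⟩, fun x y hxy => ⟨N x y hxy, fun M hM z h1 h2 => ?_⟩⟩
  · intro x y hxy
    obtain ⟨S, -, -, -, hS⟩ := exists_finset n n n hxy
    refine (S ×ˢ S).finite_toSet.subset ?_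
    rintro ⟨u, v⟩ ⟨h1, h2, h3, h4⟩
    simp only at h1 h2 h3 h4
    rw [hG u v h2.le, sum_apply] at h4
    obtain ⟨k, -, hk⟩ := Finset.exists_ne_zero_of_sum_ne_zero h4
    simp only [Finset.coe_product, Set.mem_prod, Finset.mem_coe]
    -- The first and last factors of a nonzero term of `n ^ (k + 1)` at `(u, v)` are nonzero
    -- off-diagonal entries of `n`, so both endpoints lie in `S`.
    rcases k with _ | k
    · exact absurd (by rw [pow_zero]; exact one_apply_ne h2.ne) hk
    · constructor
      · rw [pow_succ'] at hk
        obtain ⟨t, ht1, ht2, ht3, -⟩ := exists_of_mul_ne_zero hk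
        have hlt : u < t := lt_of_le_of_ne ht1 fun h' => ht3 (h' ▸ hn u)
        exact (hS u t h1 hlt (ht2.trans h3) (Or.inl ht3)).1
      · rw [pow_succ] at hk
        obtain ⟨t, ht1, ht2, -, ht3⟩ := exists_of_mul_ne_zero hk
        have hlt : t < v := lt_of_le_of_ne ht2 fun h' => ht3 (h' ▸ hn _)
        exact (hS t v (h1.trans ht1) hlt h3 (Or.inl ht3)).2
  · change G z y = _
    -- The truncation for `[z, y]` defines the entry and that for `[x, y]` is wanted; both agree
    -- with the one at their maximum.
    rw [hG z y h2, hstab x y hxy z h1 h2 M hM,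
      ← hstab x y hxy z h1 h2 _ (le_max_left (N x y hxy) (N z y h2)),
      hstab z y h2 z le_rfl h2 _ (le_max_right _ _)]

/-- An element of the finitary incidence algebra with diagonal entries `1` has a right inverse. -/
theorem exists_mul_eq_one {f : FI X K} (hf : ∀ x, f.1 x x = 1) : ∃ g, f * g = 1 := by
  have hn : ∀ x, (1 - f).1 x x = 0 := fun x => by
    rw [sub_apply, one_apply_self, hf, sub_self]
  obtain ⟨g, hg⟩ := exists_geomSum hn
  refine ⟨g, ext' fun x y hxy => ?_⟩
  obtain ⟨N₀, hN₀⟩ := hg x y hxy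
  obtain ⟨N₁, hN₁⟩ := exists_pow_apply_eq_zero hn hxy
  rw [mul_apply_congr_right (hN₀ _ (le_max_left N₀ N₁))]
  have h := mul_neg_geom_sum (1 - f) (max N₀ N₁)
  rw [sub_sub_cancel] at h
  rw [h, sub_apply, hN₁ _ (le_max_right _ _) x le_rfl, sub_zero]

/-- An element of the finitary incidence algebra with diagonal entries `1` is invertible. -/
theorem isUnit_of_apply_self_eq_one {f : FI X K} (hf : ∀ x, f.1 x x = 1) : IsUnit f := by
  obtain ⟨g, hg⟩ := exists_mul_eq_one hf
  have hg1 : ∀ x, g.1 x x = 1 := fun x => by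
    have h := mul_apply_self f g x
    rwa [hg, one_apply_self, hf, one_mul, eq_comm] at h
  obtain ⟨h, hh⟩ := exists_mul_eq_one hg1
  -- The right inverse `g` also has unit diagonal, so it has a right inverse of its own, which must
  -- be `f`.
  have : f = h := left_inv_eq_right_inv hg hh
  subst this
  exact ⟨⟨f, g, hg, hh⟩, rfl⟩

/-! ### Automorphisms preserving the diagonal idempotents up to conjugation -/

section Automorphisms

variable (φ : FI X K ≃ₐ[K] FI X K)

theorem map_e_mul_map_e_of_ne {x y : X} (h : x ≠ y) : φ (e x) * φ (e y) = 0 := by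
  rw [← map_mul, e_mul_e_of_ne h, map_zero]

theorem map_e_mul_map_e_self (x : X) : φ (e x) * φ (e x) = φ (e x) := by
  rw [← map_mul, e_mul_e_self]

variable {φ}

/-- The product `eSet A * e x` is zero, and diagonal entries multiply. -/
theorem map_eSet_apply_self_of_notMem (hφ : ∀ x, (φ (e x)).1 x x = 1) {A : Set X} {x : X}
    (hx : x ∉ A) : (φ (eSet A)).1 x x = 0 := by
  have h := mul_apply_self (φ (eSet A)) (φ (e x)) x
  rw [← map_mul, e, eSet_mul_eSet, Set.inter_singleton_eq_empty.2 hx, eSet_empty, map_zero] at h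
  have h1 := hφ x
  rw [e] at h1
  rw [h1, mul_one] at h
  exact h.symm

/-- The columns `φ(e_y)(·, y)` form a finitary function. -/
theorem finite_setOf_map_e_apply_ne_zero (hφ : ∀ x, (φ (e x)).1 x x = 1) (x y : X) :
    {p : X × X | x ≤ p.1 ∧ p.1 < p.2 ∧ p.2 ≤ y ∧ (φ (e p.2)).1 p.1 p.2 ≠ 0}.Finite := by
  have hfib : ∀ v, {u | x ≤ u ∧ u < v ∧ (φ (e v)).1 u v ≠ 0}.Finite := by
    intro v
    by_cases hxv : x ≤ v
    · refine (((φ (e v)).2 x v hxv).image Prod.fst).subset ?_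
      rintro u ⟨h1, h2, h3⟩
      exact ⟨(u, v), ⟨h1, h2, le_rfl, h3⟩, rfl⟩
    · refine Set.finite_empty.subset ?_
      rintro u ⟨h1, h2, -⟩
      exact hxv (h1.trans h2.le)
  by_contra hinf
  -- Single columns are finite, so infinitely many columns `v` are nontrivial. In each, `g v` will
  -- be the row of a maximal nonzero entry above the diagonal.
  let V : Set X := {v | v ≤ y ∧ ∃ u, x ≤ u ∧ u < v ∧ (φ (e v)).1 u v ≠ 0}
  have hV : V.Infinite := by
    intro hfin
    refine hinf ((hfin.biUnion fun v _ => (hfib v).image fun u => (u, v)).subset ?_)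
    rintro ⟨u, v⟩ ⟨h1, h2, h3, h4⟩
    exact Set.mem_biUnion (x := v) ⟨h3, u, h1, h2, h4⟩ ⟨u, ⟨h1, h2, h4⟩, rfl⟩
  have hmax : ∀ v, ∃ u, v ∈ V → Maximal (· ∈ {u | x ≤ u ∧ u < v ∧ (φ (e v)).1 u v ≠ 0}) u := by
    intro v
    by_cases hv : v ∈ V
    · obtain ⟨u, hu⟩ := (hfib v).exists_maximal hv.2
      exact ⟨u, fun _ => hu⟩
    · exact ⟨v, fun h => absurd h hv⟩
  choose g hg using hmax
  obtain ⟨A, hAV, hA, hgA⟩ := hV.exists_infinite_subset_forall_notMem g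
    fun v hv => (hg v hv).prop.2.1.ne
  obtain ⟨a₀, ha₀⟩ := hA.nonempty
  have hxy : x ≤ y :=
    (hg a₀ (hAV ha₀)).prop.1.trans ((hg a₀ (hAV ha₀)).prop.2.1.le.trans (hAV ha₀).1)
  refine (hA.image (f := fun a => (g a, a)) fun a _ b _ h => (Prod.ext_iff.1 h).2)
    (((φ (eSet A)).2 x y hxy).subset ?_)
  rintro _ ⟨v, hv, rfl⟩
  obtain ⟨hu1, hu2, hu3⟩ := (hg v (hAV hv)).prop
  refine ⟨hu1, hu2, (hAV hv).1, ?_⟩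
  -- At `(g v, v)`, maximality leaves only the terms `z = g v` and `z = v`, and the former vanishes
  -- as `g v ∉ A`. Thus `φ (eSet A)` is nonzero at infinitely many `(g v, v)`, which contradicts
  -- finitarity.
  have hmul : φ (eSet A) * φ (e v) = φ (e v) := by
    rw [← map_mul, e, eSet_mul_eSet, Set.inter_eq_right.2 (by simpa using hv)]
  rw [← hmul, mul_apply_eq_sum _ _ (g v) v {v} (by simpa using hu2.le),
    Finset.sum_singleton] at hu3
  · exact left_ne_zero_of_mul hu3
  · intro z h1 h2 h3 h4
    by_contra hne
    have hzv : z < v := lt_of_le_of_ne h2 fun h => hne (Finset.mem_singleton.2 h)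
    rw [le_antisymm ((hg v (hAV hv)).le_of_ge ⟨hu1.trans h1, hzv, h4⟩ h1) h1] at h3
    exact h3 (map_eSet_apply_self_of_notMem hφ (hgA v hv))

/-- An automorphism `φ` for which every `φ(e_x)` has diagonal `e_x` agrees on all `e_x` with an
inner automorphism. -/
theorem exists_unit_map_e_eq (hφ : ∀ x, (φ (e x)).1 x x = 1) :
    ∃ w : (FI X K)ˣ, ∀ x, φ (e x) = w * (e x : FI X K) * (w⁻¹ : (FI X K)ˣ) := by
  classical
  let W : FI X K := ⟨⟨fun x y => (φ (e y)).1 x y,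
    fun x y h => IncidenceAlgebra.apply_eq_zero_of_not_le h _⟩,
    fun x y _ => finite_setOf_map_e_apply_ne_zero hφ x y⟩
  have hW : ∀ x y, W.1 x y = (φ (e y)).1 x y := fun _ _ => rfl
  obtain ⟨w, hw⟩ := isUnit_of_apply_self_eq_one (f := W) hφ
  refine ⟨w, fun x => ?_⟩
  rw [← Units.mul_inv_eq_iff_eq_mul, inv_inv, hw]
  apply ext'
  intro u v _
  have h : (φ (e x) * W).1 u v = (φ (e x) * φ (e v)).1 u v :=
    mul_apply_congr_right fun z _ _ => hW z v
  rw [h, e, mul_eSet_apply, ← e, Set.mem_singleton_iff]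
  split_ifs with hvx
  · rw [hvx, map_e_mul_map_e_self, hW]
  · rw [map_e_mul_map_e_of_ne φ (Ne.symm hvx)]
    rfl

/-- An automorphism fixing every `e_x` is multiplicative. -/
theorem exists_eq_multAut (hφ : ∀ x, φ (e x) = e x) :
    ∃ (σ : IncidenceAlgebra K X) (hσ : IsMultiplicative σ), φ = multAut σ hσ := by
  classical
  let σ : IncidenceAlgebra K X := ⟨fun x y => if h : x ≤ y then (φ (single h)).1 x y else 0,
    fun x y h => dif_neg h⟩
  -- Hence `φ` preserves each line `e x * FI X K * e y`, spanned by a matrix unit, and acts on it by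
  -- a scalar.
  have hφe : ∀ x y f, φ (e x * f * e y) = e x * φ f * e y := fun x y f => by
    rw [map_mul, map_mul, hφ, hφ]
  have hσ : ∀ x y (h : x ≤ y), φ (single h) = σ x y • single h := by
    intro x y h
    have h1 : σ x y = (φ (single h)).1 x y := dif_pos h
    rw [h1, ← e_mul_mul_e, ← hφe, e_mul_mul_e _ h, single_apply_self, one_smul]
  have happ : ∀ f x y, x ≤ y → (φ f).1 x y = σ x y * f.1 x y := by
    intro f x y h
    have h1 : (φ f).1 x y • (single h : FI X K) = (f.1 x y * σ x y) • single h := by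
      rw [← e_mul_mul_e, ← hφe, e_mul_mul_e _ h, map_smul, hσ, smul_smul]
    have h2 := congrArg (fun f : FI X K => f.1 x y) h1
    simp only [smul_apply, single_apply_self, mul_one] at h2
    rw [h2, mul_comm]
  refine ⟨σ, ⟨fun x y h h0 => ?_, fun x y z hxy hyz => ?_⟩, ?_⟩
  · have h1 := hσ x y h
    rw [h0, zero_smul] at h1
    have h2 := (map_eq_zero_iff φ φ.injective).1 h1
    have h3 := single_apply_self (K := K) h
    rw [h2] at h3
    exact zero_ne_one h3
  · have h1 := congrArg φ (single_mul_single (K := K) hxy hyz)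
    rw [map_mul, hσ, hσ, hσ, smul_mul_assoc, mul_smul_comm, smul_smul, single_mul_single] at h1
    have h2 := congrArg (fun f : FI X K => f.1 x z) h1
    simpa only [smul_apply, single_apply_self, mul_one] using h2
  · exact AlgEquiv.ext fun f => ext' fun x y h => happ f x y h

/-- If all multiplicative automorphisms are inner, then so is every automorphism `φ` for which
every `φ(e_x)` has diagonal `e_x`. -/
theorem isInnerAut_of_map_e_apply_self
    (hmult : ∀ (σ : IncidenceAlgebra K X) (hσ : IsMultiplicative σ), IsInnerAut (multAut σ hσ))
    (hφ : ∀ x, (φ (e x)).1 x x = 1) : IsInnerAut φ := by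
  obtain ⟨w, hw⟩ := exists_unit_map_e_eq hφ
  let ψ : FI X K ≃ₐ[K] FI X K :=
    φ.trans (MulSemiringAction.toAlgEquiv K (FI X K) (ConjAct.toConjAct w⁻¹))
  have hψ : ∀ a, ψ a = (w⁻¹ : (FI X K)ˣ) * φ a * w := fun a => by
    change ConjAct.toConjAct w⁻¹ • φ a = _
    rw [ConjAct.units_smul_def, ConjAct.ofConjAct_toConjAct, inv_inv]
  obtain ⟨σ, hσ, hψσ⟩ := exists_eq_multAut (φ := ψ) fun x => by
    rw [hψ, hw]
    simp [mul_assoc]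
  obtain ⟨t, ht⟩ := hmult σ hσ
  refine ⟨w * t, fun a => ?_⟩
  have h := ht a
  rw [← hψσ, hψ] at h
  rw [Units.val_mul, mul_inv_rev, Units.val_mul]
  calc φ a = w * ((w⁻¹ : (FI X K)ˣ) * φ a * w) * (w⁻¹ : (FI X K)ˣ) := by simp [mul_assoc]
    _ = _ := by rw [h]; simp only [mul_assoc]

end Automorphisms

/-! ### The involution `ρ_λ^*` -/

section Rho

variable {lam : X → X} (hlam : IsPosetInvolution lam) {star : K → K} (hstar : IsInvolution star)

theorem isInvolution_rho : IsInvolution (rho hlam hstar : FI X K → FI X K) where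
  map_add f g := ext' fun x y _ => by
    simp only [rho_apply, add_apply, hstar.map_add]
  map_mul f g := ext' fun x y hxy => by
    have hfin : ((Set.Icc (lam y) (lam x)) ∩
        Function.support fun z => f.1 (lam y) z * g.1 z (lam x)).Finite := by
      obtain ⟨S, h1, h2, -, hS⟩ := exists_finset f g g ((hlam.le_iff x y).1 hxy)
      refine S.finite_toSet.subset ?_
      rintro z ⟨hz, hne⟩
      rcases hz.1.eq_or_lt with rfl | hlt
      · exact h1
      · exact (hS _ _ le_rfl hlt hz.2 (Or.inl (left_ne_zero_of_mul hne))).2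
    rw [rho_apply, mul_apply, mul_apply]
    let s : K →+ K := AddMonoidHom.mk' star hstar.map_add
    change s _ = _
    rw [s.map_finsum_mem' hfin]
    symm
    refine finsum_mem_eq_of_bijOn lam ⟨fun z hz => ⟨(hlam.le_iff _ _).1 hz.2,
      (hlam.le_iff _ _).1 hz.1⟩, fun a _ b _ h => ?_, fun z hz => ⟨lam z, ⟨?_, ?_⟩,
        hlam.apply_apply z⟩⟩ fun z hz => ?_
    · rw [← hlam.apply_apply a, h, hlam.apply_apply]
    · rw [hlam.le_iff, hlam.apply_apply]; exact hz.2
    · rw [hlam.le_iff, hlam.apply_apply]; exact hz.1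
    · change _ = star _
      rw [hstar.map_mul]
      rfl
  apply_apply f := ext' fun x y _ => by
    simp only [rho_apply, hlam.apply_apply, hstar.apply_apply]

theorem rho_smul (k : K) (f : FI X K) :
    rho hlam hstar (k • f) = star k • rho hlam hstar f := ext' fun x y _ => by
  rw [rho_apply, smul_apply, smul_apply, rho_apply, hstar.map_mul, mul_comm]

theorem rho_eSet {D : Set X} (hD : ∀ x, lam x ∈ D ↔ x ∉ D) :
    rho hlam hstar (eSet D : FI X K) = 1 - eSet D := ext' fun x y _ => by
  rw [rho_apply, sub_apply]
  by_cases hxy : x = y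
  · subst hxy
    rw [one_apply_self]
    by_cases hx : x ∈ D
    · rw [eSet_apply_of_notMem (fun h => (hD x).1 h hx), eSet_apply_self_of_mem hx, sub_self,
        hstar.map_zero]
    · rw [eSet_apply_self_of_mem ((hD x).2 hx), eSet_apply_of_notMem hx, sub_zero,
        hstar.map_one]
  · have hne : lam y ≠ lam x := fun h => hxy (by
      rw [← hlam.apply_apply x, ← h, hlam.apply_apply])
    rw [eSet_apply_of_ne _ hne, eSet_apply_of_ne _ hxy, one_apply_ne hxy, sub_zero,
      hstar.map_zero]

/-- If `x ≤ y` and `y ∈ D`, then `x ∈ D`. This gives block triangularity of a unit and of its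
inverse alike. -/
theorem eSet_mul_mul_eSet_of_isLowerSet {D : Set X} (hD : IsLowerSet D) (f : FI X K) :
    eSet D * (f * eSet D) = f * eSet D := ext' fun x y hxy => by
  classical
  rw [eSet_mul_apply, mul_eSet_apply]
  by_cases hy : y ∈ D
  · rw [if_pos (hD hxy hy)]
  · simp [hy]

variable {ρ : FI X K → FI X K}

theorem map_smul_of_inducesOnField (hρ : IsInvolution ρ) (hρK : InducesOnField ρ star) (k : K)
    (f : FI X K) : ρ (k • f) = star k • ρ f := by
  rw [Algebra.smul_def, hρ.map_mul, hρK, ← Algebra.commutes, ← Algebra.smul_def]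

/-- The automorphism `ρ_λ^* ∘ ρ`, for an involution `ρ` inducing `*` on the base field. -/
noncomputable def rhoComp (hρ : IsInvolution ρ) (hρK : InducesOnField ρ star) : FI X K ≃ₐ[K] FI X K :=
  AlgEquiv.ofLinearEquiv
    { toFun := fun f => rho hlam hstar (ρ f)
      invFun := fun f => ρ (rho hlam hstar f)
      map_add' := fun f g => by rw [hρ.map_add, (isInvolution_rho hlam hstar).map_add]
      map_smul' := fun k f => by
        rw [map_smul_of_inducesOnField hρ hρK, rho_smul, hstar.apply_apply, RingHom.id_apply]
      left_inv := fun f => by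
        simp only [(isInvolution_rho hlam hstar).apply_apply, hρ.apply_apply]
      right_inv := fun f => by
        simp only [(isInvolution_rho hlam hstar).apply_apply, hρ.apply_apply] }
    (by
      change rho hlam hstar (ρ 1) = 1
      rw [hρ.map_one, (isInvolution_rho hlam hstar).map_one])
    fun f g => by
      change rho hlam hstar (ρ (f * g)) = rho hlam hstar (ρ f) * rho hlam hstar (ρ g)
      rw [hρ.map_mul, (isInvolution_rho hlam hstar).map_mul]

theorem rhoComp_apply (hρ : IsInvolution ρ) (hρK : InducesOnField ρ star) (f : FI X K) :
    rhoComp hlam hstar hρ hρK f = rho hlam hstar (ρ f) := rfl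

/-- Conjugation does not change diagonal entries. The hypothesis that `ρ` induces `lam` enters only
through this fact. -/
theorem rhoComp_e_apply_self (hρ : IsInvolution ρ) (hρK : InducesOnField ρ star)
    (hρX : InducesOnPoset ρ lam) (x : X) : (rhoComp hlam hstar hρ hρK (e x)).1 x x = 1 := by
  obtain ⟨u, hu⟩ := hρX x
  have h := mul_apply_self (u : FI X K) (u⁻¹ : (FI X K)ˣ) (lam x)
  rw [Units.mul_inv, one_apply_self] at h
  rw [rhoComp_apply, rho_apply, hu, mul_apply_self, mul_apply_self, e,
    eSet_apply_self_of_mem (Set.mem_singleton _), mul_one, ← h, hstar.map_one]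

/-- If multiplicative automorphisms are inner, an involution inducing `λ` and `*` is `ρ_λ^*`
followed by an inner automorphism. -/
theorem exists_unit_eq_mul_rho_mul
    (hmult : ∀ (σ : IncidenceAlgebra K X) (hσ : IsMultiplicative σ), IsInnerAut (multAut σ hσ))
    (hρ : IsInvolution ρ) (hρX : InducesOnPoset ρ lam) (hρK : InducesOnField ρ star) :
    ∃ v : (FI X K)ˣ, ∀ f, ρ f = v * rho hlam hstar f * (v⁻¹ : (FI X K)ˣ) := by
  have hr := isInvolution_rho (X := X) hlam hstar
  obtain ⟨s, hs⟩ := isInnerAut_of_map_e_apply_self hmult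
    (rhoComp_e_apply_self hlam hstar hρ hρK hρX)
  -- Applying `r` to `r (ρ f) = s * f * s⁻¹` reverses the product and puts `(r s)⁻¹` on the left.
  refine ⟨(hr.mapUnit s)⁻¹, fun f => ?_⟩
  have h := congrArg (rho hlam hstar) (hs f)
  rw [rhoComp_apply, hr.apply_apply, hr.map_mul, hr.map_mul, ← mul_assoc] at h
  rw [h, inv_inv]
  rfl

/-- The unit in `exists_unit_eq_mul_rho_mul` can be chosen symmetric when `*` is of the second
kind. -/
theorem exists_symmetric_unit_eq_mul_rho_mul (hX : PosetConnected X) [Nonempty X]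
    (hstar₂ : IsInvolutionOfSecondKind star) (hρ : IsInvolution ρ) (v : (FI X K)ˣ)
    (hv : ∀ f, ρ f = v * rho hlam hstar f * (v⁻¹ : (FI X K)ˣ)) :
    ∃ w : (FI X K)ˣ, rho hlam hstar (w : FI X K) = w ∧
      ∀ f, ρ f = w * rho hlam hstar f * (w⁻¹ : (FI X K)ˣ) := by
  have hr := isInvolution_rho (X := X) hlam hstar
  set r : FI X K → FI X K := rho hlam hstar with hrdef
  let rv := hr.mapUnit v
  have hrv : (rv : FI X K) = r v := rfl
  have hrv' : ((rv⁻¹ : (FI X K)ˣ) : FI X K) = r (v⁻¹ : (FI X K)ˣ) := rfl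
  -- Expanding `ρ (ρ a) = a` shows that conjugation by `v * (r v)⁻¹` is trivial.
  obtain ⟨k, hk⟩ := exists_eq_algebraMap_of_central (K := K) hX
    (z := ((v * rv⁻¹ : (FI X K)ˣ) : FI X K)) fun a => by
      have h := hρ.apply_apply a
      rw [hv, hv, hr.map_mul, hr.map_mul, hr.apply_apply, ← hrv, ← hrv'] at h
      rw [Units.val_mul]
      calc (v : FI X K) * (rv⁻¹ : (FI X K)ˣ) * a
          = v * ((rv⁻¹ : (FI X K)ˣ) * (a * rv)) * (v⁻¹ : (FI X K)ˣ) *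
            (v * (rv⁻¹ : (FI X K)ˣ)) := by simp [mul_assoc]
        _ = _ := by rw [h]
  have hvk : (v : FI X K) = k • r v := by
    rw [Algebra.smul_def, ← hk, ← hrv, Units.val_mul, mul_assoc, Units.inv_mul, mul_one]
  have hrvk : r v = star k • (v : FI X K) := by
    conv_lhs => rw [hvk]
    rw [hrdef, rho_smul, ← hrdef, hr.apply_apply]
  have : Nontrivial (FI X K) := by
    obtain ⟨x⟩ := ‹Nonempty X›
    refine ⟨1, 0, fun h => ?_⟩
    have h1 := one_apply_self (K := K) x
    rw [h] at h1
    exact zero_ne_one h1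
  have hkk : k * star k = 1 := by
    have h1 : (k * star k - 1) • (v : FI X K) = 0 := by
      rw [sub_smul, one_smul, mul_smul, ← hrvk, ← hvk, sub_self]
    exact sub_eq_zero.1 ((smul_eq_zero.1 h1).resolve_right v.ne_zero)
  obtain ⟨c, hc, hck⟩ := hstar₂.exists_mul_eq hkk
  refine ⟨Units.mk0 c hc • v, ?_, fun f => ?_⟩
  · change r (c • (v : FI X K)) = c • (v : FI X K)
    rw [hrdef, rho_smul, ← hrdef, hrvk, smul_smul, hck]
  · rw [hv]
    change _ = c • (v : FI X K) * r f * (c⁻¹ • ((v⁻¹ : (FI X K)ˣ) : FI X K))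
    rw [smul_mul_assoc, smul_mul_assoc, mul_smul_comm, smul_smul, mul_inv_cancel₀ hc, one_smul]

end Rho

end FI

/-! ### Equivalence of the two involutions -/

/-- Two involutions that differ by conjugation by `h * r h` are equivalent via the inner
automorphism given by `h⁻¹`. -/
theorem equivalentViaInner_of_eq_mul_map {K A : Type*} [Field K] [Ring A] [Algebra K A]
    {ρ r : A → A} (hr : IsInvolution r) (v h : Aˣ) (hv : (v : A) = h * r h)
    (hρ : ∀ a, ρ a = v * r a * (v⁻¹ : Aˣ)) : EquivalentViaInner K ρ r := by
  have hΦ : ∀ a, MulSemiringAction.toAlgEquiv K A (ConjAct.toConjAct h⁻¹) a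
      = (h⁻¹ : Aˣ) * a * h := fun a => by
    change ConjAct.toConjAct h⁻¹ • a = _
    rw [ConjAct.units_smul_def, ConjAct.ofConjAct_toConjAct, inv_inv]
  refine ⟨MulSemiringAction.toAlgEquiv K A (ConjAct.toConjAct h⁻¹), ⟨h⁻¹, fun a => ?_⟩,
    funext fun a => ?_⟩
  · rw [hΦ, inv_inv]
  · have hv' : v = h * hr.mapUnit h := Units.ext hv
    have h1 : ((hr.mapUnit h : Aˣ) : A) = r h := rfl
    have h2 : (((hr.mapUnit h)⁻¹ : Aˣ) : A) = r (h⁻¹ : Aˣ) := rfl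
    rw [Function.comp_apply, Function.comp_apply, hΦ, hΦ, hρ, hr.map_mul, hr.map_mul, ← h1, ← h2,
      hv', mul_inv_rev, Units.val_mul, Units.val_mul]
    simp [mul_assoc]

theorem theorem4p7 {X K : Type*} [PartialOrder X] [Field K]
    (hchar : ringChar K ≠ 2)
    (hX : PosetConnected X)
    (hmult : ∀ (σ : IncidenceAlgebra K X) (hσ : FI.IsMultiplicative σ),
      IsInnerAut (FI.multAut σ hσ))
    {star : K → K} (hstar : IsInvolutionOfSecondKind star)
    {lam : X → X} (hlam : IsPosetInvolution lam) (hfix : ∀ x, lam x ≠ x)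
    (ρ : FI X K → FI X K) (hρ : IsInvolution ρ)
    (hρX : FI.InducesOnPoset ρ lam) (hρK : FI.InducesOnField ρ star) :
    EquivalentViaInner K ρ (FI.rho hlam hstar.1) := by
  have hr := FI.isInvolution_rho (X := X) hlam hstar.1
  -- For empty `X` the algebra is zero, and `k * star k = 1` could not be deduced from its action on
  -- `v`.
  rcases isEmpty_or_nonempty X with hE | hne
  · exact ⟨AlgEquiv.refl, ⟨1, fun a => FI.ext' fun x => hE.elim x⟩,
      funext fun a => FI.ext' fun x => hE.elim x⟩
  obtain ⟨v₀, hv₀⟩ := FI.exists_unit_eq_mul_rho_mul hlam hstar.1 hmult hρ hρX hρK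
  obtain ⟨v, hsymm, hv⟩ :=
    FI.exists_symmetric_unit_eq_mul_rho_mul hlam hstar.1 hX hstar hρ v₀ hv₀
  obtain ⟨D, hlow, hD⟩ := hlam.exists_isLowerSet hfix
  have h2 : (2 : K) ≠ 0 := Ring.two_ne_zero hchar
  have hstar2 : star 2⁻¹ = 2⁻¹ := by
    have h : star 2 = 2 := by
      rw [← one_add_one_eq_two, hstar.1.map_add, hstar.1.map_one]
    have h' := hstar.1.map_mul 2 2⁻¹
    rw [mul_inv_cancel₀ h2, hstar.1.map_one, h] at h'
    exact eq_inv_of_mul_eq_one_left h'.symm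
  obtain ⟨h, hh⟩ := hr.exists_eq_mul_map h2
    (fun a => by rw [FI.rho_smul, hstar2]) (e := FI.eSet D)
    (by rw [FI.eSet_mul_eSet, Set.inter_self]) (FI.rho_eSet hlam hstar.1 hD) v hsymm
    (FI.eSet_mul_mul_eSet_of_isLowerSet hlow _) (FI.eSet_mul_mul_eSet_of_isLowerSet hlow _)
  exact equivalentViaInner_of_eq_mul_map hr v h hh hv
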